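/- Let $k\ge 2$ be an integer, $\alpha>0$, $q:=k^{-\alpha}\in(0,1)$ and $\gamma:=\log k$. For $n\ge 0$ let $\mathbb T_n$ be the set of the $k^n$ intervals $[m/k^n,(m+1)/k^n)$, $0\le m<k^n$, and let $\mathbb T=\bigcup_{n\ge0}\mathbb T_n$; write $|v|=n$ for $v\in\mathbb T_n$, and call $w\in\mathbb T_{n+1}$ a child of $v\in\mathbb T_n$ if $w\subseteq v$. Let $(W^{(v)})_{v\in\mathbb T}$ be independent standard exponential random variables, and define $S([0,1))=W^{([0,1))}$, $S(w)=S(v)+q^{-|w|}W^{(w)}$ whenever $w$ is a child of $v$, and $K(v)=q^{|v|}S(v)$. (In the $k$-regular self-similar fragmentation of index $\alpha$, started from $[0,1)$, in which each interval of size $u$ breaks independently at rate $u^\alpha$ into $k$ equal intervals, $S(v)$ is the time at which $v$ breaks.) Put $$\tau_n:=\max_{v\in\mathbb T_n}K(v)-\gamma n,\qquad \varphi_\infty(q):=\prod_{i=1}^\infty(1-q^i)\in(0,1).$$ Then, as $n\to\infty$, $\tau_n$ converges in distribution to the shifted Gumbel random variable $G-\log\varphi_\infty(q)$, where $\mathbb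 P(G\le s)=\exp(-e^{-s})$ for $s\in\mathbb R$; that is, for every $s\in\mathbb R$, $$\lim_{n\to\infty}\mathbb P(\tau_n\le s)=\exp\!\left(-\,e^{-s}/\varphi_\infty(q)\right).$$ -/

import Mathlib

open MeasureTheory ProbabilityTheory Filter Topology

namespace ExpandingBRW

/-- The parameter `q = k ^ (-α)`. -/
noncomputable def q (k : ℕ) (α : ℝ) : ℝ := (k : ℝ) ^ (-α)

lemma q_pos {k : ℕ} (hk : 2 ≤ k) (α : ℝ) : 0 < q k α :=
  Real.rpow_pos_of_pos (by exact_mod_cast (by omega : 0 < k)) _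

lemma q_lt_one {k : ℕ} (hk : 2 ≤ k) {α : ℝ} (hα : 0 < α) : q k α < 1 :=
  Real.rpow_lt_one_of_one_lt_of_neg (by exact_mod_cast (by omega : 1 < k)) (by linarith)

/-- The Euler function `φ_∞(q) = ∏_{i ≥ 1} (1 - q ^ i)`. -/
noncomputable def phiInf (q : ℝ) : ℝ := ∏' i : ℕ, (1 - q ^ (i + 1))

lemma summable_neg_pow {q : ℝ} (h0 : 0 < q) (h1 : q < 1) :
    Summable fun i : ℕ => -q ^ (i + 1) :=
  ((summable_nat_add_iff 1).2 (summable_geometric_of_lt_one h0.le h1)).neg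

/-- The product defining the Euler function converges for `0 < q < 1`. -/
lemma multipliable_phiInf {q : ℝ} (h0 : 0 < q) (h1 : q < 1) :
    Multipliable fun i : ℕ => 1 - q ^ (i + 1) := by
  simpa [sub_eq_add_neg] using Real.multipliable_one_add_of_summable (summable_neg_pow h0 h1)

/-- The partial products `φ_n(q) = ∏_{1 ≤ j ≤ n} (1 - q ^ j)` converge to `φ_∞(q)`. -/
lemma tendsto_phiInf {q : ℝ} (h0 : 0 < q) (h1 : q < 1) :
    Tendsto (fun n : ℕ => ∏ j ∈ Finset.range n, (1 - q ^ (j + 1))) atTop (𝓝 (phiInf q)) :=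
  (multipliable_phiInf h0 h1).hasProd.tendsto_prod_nat

/-- The Euler function is strictly positive on `(0, 1)`. -/
lemma phiInf_pos {q : ℝ} (h0 : 0 < q) (h1 : q < 1) : 0 < phiInf q := by
  have hpos : ∀ i : ℕ, 0 < 1 - q ^ (i + 1) := fun i =>
    sub_pos.2 (pow_lt_one₀ h0.le h1 (Nat.succ_ne_zero i))
  have hne : phiInf q ≠ 0 := by
    have hs : Summable fun i : ℕ => ‖-q ^ (i + 1)‖ := (summable_neg_pow h0 h1).norm
    have h := tprod_one_add_ne_zero_of_summable (f := fun i : ℕ => -q ^ (i + 1))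
      (fun i => by simpa [sub_eq_add_neg] using (hpos i).ne') hs
    simpa [phiInf, sub_eq_add_neg] using h
  exact lt_of_le_of_ne (ge_of_tendsto' (tendsto_phiInf h0 h1)
    fun n => Finset.prod_nonneg fun i _ => (hpos i).le) hne.symm

/-- The `n`-th generation `𝕋_n` of the tree: the index `m : Fin (k ^ n)` stands for the
interval `[m / k ^ n, (m + 1) / k ^ n)`. -/
abbrev Gen (k n : ℕ) : Type := Fin (k ^ n)

/-- The interval `[m / k ^ n, (m + 1) / k ^ n)` represented by `m`. -/
def interval {k n : ℕ} (m : Gen k n) : Set ℝ :=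
  Set.Ico ((m : ℕ) / (k : ℝ) ^ n) (((m : ℕ) + 1) / (k : ℝ) ^ n)

/-- The vertex set `𝕋 = ⋃_n 𝕋_n`. -/
abbrev Vertex (k : ℕ) : Type := Σ n : ℕ, Gen k n

/-- The parent of an interval of size `k ^ (-(n + 1))` is the interval of size `k ^ (-n)`
that contains it, see `interval_subset_parent`. -/
def parent {k n : ℕ} (v : Gen k (n + 1)) : Gen k n :=
  ⟨(v : ℕ) / k, Nat.div_lt_of_lt_mul (lt_of_lt_of_eq v.2 (pow_succ' k n))⟩

lemma interval_subset_parent {k n : ℕ} (hk : 0 < k) (v : Gen k (n + 1)) :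
    interval v ⊆ interval (parent v) := by
  have hk' : (0 : ℝ) < k := by exact_mod_cast hk
  have hkn : (0 : ℝ) < (k : ℝ) ^ n := by positivity
  have e : ∀ a : ℝ, a / (k : ℝ) ^ n = a * k / (k : ℝ) ^ (n + 1) := fun a => by
    rw [pow_succ]; field_simp
  apply Set.Ico_subset_Ico
  · rw [e]
    gcongr
    exact_mod_cast Nat.div_mul_le_self (v : ℕ) k
  · rw [e]
    gcongr
    exact_mod_cast Nat.succ_le_of_lt (Nat.lt_mul_of_div_lt (Nat.lt_succ_self ((v : ℕ) / k)) hk)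

/-- The expanding branching random walk driven by the variables `W`: the time `S(v)` at which
the interval `v` breaks. The interval `v` with `|v| = n` lives for the time `q ^ (-n) * W v`,
counted from the time at which its parent breaks (from time `0` for the root `[0, 1)`). -/
noncomputable def S {Ω : Type*} {k : ℕ} (q : ℝ) (W : Vertex k → Ω → ℝ) :
    (n : ℕ) → Gen k n → Ω → ℝ
  | 0, v, ω => W ⟨0, v⟩ ω
  | n + 1, v, ω => S q W n (parent v) ω + (q ^ (n + 1))⁻¹ * W ⟨n + 1, v⟩ ω

/-- The rescaled expanding branching random walk `K(v) = q ^ |v| * S(v)`. -/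
noncomputable def K {Ω : Type*} {k : ℕ} (q : ℝ) (W : Vertex k → Ω → ℝ)
    (n : ℕ) (v : Gen k n) (ω : Ω) : ℝ :=
  q ^ n * S q W n v ω

/-- `K(w) = q * K(v) + W w` whenever `w` is a child of `v`. -/
lemma K_succ {Ω : Type*} {k : ℕ} {q : ℝ} (hq : q ≠ 0) (W : Vertex k → Ω → ℝ)
    (n : ℕ) (w : Gen k (n + 1)) (ω : Ω) :
    K q W (n + 1) w ω = q * K q W n (parent w) ω + W ⟨n + 1, w⟩ ω := by
  simp only [K, S, mul_add, pow_succ]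
  field_simp

/-- `K^max_n = max {K(v) : v ∈ 𝕋_n}`. -/
noncomputable def Kmax {Ω : Type*} {k : ℕ} (q : ℝ) (W : Vertex k → Ω → ℝ)
    (n : ℕ) (ω : Ω) : ℝ :=
  ⨆ v : Gen k n, K q W n v ω

/-- The supremum is a genuine maximum. -/
lemma isGreatest_Kmax {Ω : Type*} {k : ℕ} (hk : 0 < k) (q : ℝ) (W : Vertex k → Ω → ℝ)
    (n : ℕ) (ω : Ω) :
    IsGreatest (Set.range fun v : Gen k n => K q W n v ω) (Kmax q W n ω) := by
  have : Nonempty (Gen k n) := ⟨⟨0, by positivity⟩⟩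
  obtain ⟨v, hv⟩ := exists_eq_ciSup_of_finite (f := fun v : Gen k n => K q W n v ω)
  refine ⟨⟨v, hv⟩, ?_⟩
  rintro _ ⟨w, rfl⟩
  exact le_ciSup (f := fun v : Gen k n => K q W n v ω) (Set.finite_range _).bddAbove w

/-- `τ_n = K^max_n - γ n` with `γ = log k`. -/
noncomputable def tau {Ω : Type*} {k : ℕ} (q : ℝ) (W : Vertex k → Ω → ℝ)
    (n : ℕ) (ω : Ω) : ℝ :=
  Kmax q W n ω - Real.log k * n

/-- The distribution function `s ↦ exp (-e ^ (-s))` of the standard Gumbel law. -/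
noncomputable def gumbelCDF : StieltjesFunction ℝ where
  toFun s := Real.exp (-Real.exp (-s))
  mono' := fun a b h =>
    Real.exp_le_exp.2 (neg_le_neg (Real.exp_le_exp.2 (neg_le_neg h)))
  right_continuous' := fun x =>
    (Real.continuous_exp.comp (Real.continuous_exp.comp continuous_neg).neg).continuousWithinAt

/-- The standard Gumbel law, i.e. the law on `ℝ` with distribution function `gumbelCDF`. -/
noncomputable def gumbelMeasure : Measure ℝ := gumbelCDF.measure

instance : IsProbabilityMeasure gumbelMeasure := by
  refine gumbelCDF.isProbabilityMeasure ?_ ?_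
  · exact Real.tendsto_exp_atBot.comp
      (tendsto_neg_atTop_atBot.comp (Real.tendsto_exp_atTop.comp tendsto_neg_atBot_atTop))
  · have h : Tendsto (fun s : ℝ => -Real.exp (-s)) atTop (𝓝 0) := by
      simpa using Real.tendsto_exp_neg_atTop_nhds_zero.neg
    simpa [gumbelCDF, Function.comp_def] using (Real.continuous_exp.tendsto 0).comp h

end ExpandingBRW

namespace ExpandingBRW

/-! ### The standard exponential law -/

/-! Condition on the first `n` generations. With `x = s + γ(n+1)`, a child of `v` stays below `x`
with probability `(1 - exp(-x) exp(q K(v)))₊`, and `exp(-x) = exp(-s) / k^(n+1)`. The product over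
the `k^(n+1)` children is therefore close to `exp(-exp(-s) M_n)`, where `M_n = k⁻ⁿ ∑_{|v|=n} exp(q
K(v))`. The variables `exp(q K(v))` have mean `∏_{i≤n} (1 - q^(i+1))⁻¹ → 1/φ_∞(q)`, and the limit
law appears once `M_n` is seen to concentrate at its mean.

The Laplace functional of `M_n` is squeezed. Jensen's inequality bounds it below (`le_laplace`). For
the upper bound, averaging over one generation replaces `(L, a)` by `(L/(1-a), aq)` up to a
vanishing error (`laplace_succ_le`). After `J` such steps the crude bound `K ≥ 0` leaves `exp(-L
∏_{i<J} (1 - q^i a)⁻¹)`; then `n → ∞`, followed by `J → ∞`.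

Errors are measured in a moment of order `θ ∈ (1, 2]` with `θq < 1`: the second moment of `exp(qW)`
is infinite for `q ≥ 1/2`, while any `θ > 1` already makes the total error decay like `k^(n(1-θ))`.
-/

instance isProbabilityMeasure_expMeasure_one : IsProbabilityMeasure (expMeasure 1) :=
  isProbabilityMeasure_expMeasure one_pos

lemma expMeasure_one_real_Iic (x : ℝ) :
    (expMeasure 1).real (Set.Iic x) = max (1 - Real.exp (-x)) 0 := by
  rw [← cdf_eq_real, cdf_expMeasure_eq one_pos, one_mul]
  split_ifs with h
  · rw [max_eq_left]
    simpa using h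
  · rw [max_eq_right]
    rw [sub_nonpos, Real.one_le_exp_iff]
    linarith

lemma ae_nonneg_expMeasure_one : ∀ᵐ w ∂expMeasure 1, 0 ≤ w := by
  have h : (expMeasure 1).real (Set.Iic 0) = 0 := by rw [expMeasure_one_real_Iic]; simp
  rw [measureReal_eq_zero_iff] at h
  filter_upwards [measure_eq_zero_iff_ae_notMem.1 h] with w hw
  exact (not_le.1 hw).le

lemma expMeasure_one_eq_withDensity :
    expMeasure 1 = volume.withDensity
      fun x => ENNReal.ofReal ((Set.Ici (0 : ℝ)).indicator (fun x => Real.exp (-x)) x) := by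
  rw [expMeasure, gammaMeasure]
  congr 1
  ext x
  rw [gammaPDF_eq]
  congr 1
  by_cases hx : 0 ≤ x <;> simp [hx, Set.indicator]

lemma integrable_iff_expMeasure_one (f : ℝ → ℝ) :
    Integrable f (expMeasure 1) ↔ IntegrableOn (fun x => Real.exp (-x) * f x) (Set.Ioi 0) := by
  rw [expMeasure_one_eq_withDensity, integrable_withDensity_iff_integrable_smul₀'
    (by fun_prop (disch := measurability)) (by simp)]
  rw [← integrableOn_Ici_iff_integrableOn_Ioi, ← integrable_indicator_iff measurableSet_Ici]
  refine iff_of_eq (congrArg (Integrable · _) ?_)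
  ext x
  by_cases hx : 0 ≤ x <;> simp [hx, Set.indicator, Real.exp_nonneg]

lemma integral_expMeasure_one (f : ℝ → ℝ) :
    ∫ x, f x ∂expMeasure 1 = ∫ x in Set.Ioi 0, Real.exp (-x) * f x := by
  rw [expMeasure_one_eq_withDensity, integral_withDensity_eq_integral_toReal_smul₀
    (by fun_prop (disch := measurability)) (by simp), ← integral_Ici_eq_integral_Ioi,
    ← integral_indicator measurableSet_Ici]
  congr 1
  ext x
  by_cases hx : 0 ≤ x <;> simp [hx, Set.indicator, Real.exp_nonneg]

lemma integrable_exp_mul_expMeasure_one {a : ℝ} (ha : a < 1) :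
    Integrable (fun w => Real.exp (a * w)) (expMeasure 1) := by
  rw [integrable_iff_expMeasure_one]
  refine (integrableOn_exp_mul_Ioi (a := a - 1) (by linarith) 0).congr_fun (fun x _ => ?_)
    measurableSet_Ioi
  simp only [← Real.exp_add]
  ring_nf

lemma integral_exp_mul_expMeasure_one {a : ℝ} (ha : a < 1) :
    ∫ w, Real.exp (a * w) ∂expMeasure 1 = (1 - a)⁻¹ := by
  have h := integral_exp_mul_Ioi (a := a - 1) (by linarith) 0
  rw [integral_expMeasure_one]
  have e : ∀ x : ℝ, Real.exp (-x) * Real.exp (a * x) = Real.exp ((a - 1) * x) := fun x => by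
    rw [← Real.exp_add]; ring_nf
  simp only [e, h, mul_zero, Real.exp_zero]
  rw [← neg_sub 1 a, div_neg, neg_div, neg_neg, one_div]

/-! ### Elementary inequalities -/

/-- Factors in `[0, 1]` cannot amplify an error, so errors add up when factors are exchanged one at
a time. The `d i` need no upper bound, which admits exponential errors in `K(v)`. -/
lemma prod_le_prod_add_sum {ι : Type*} (s : Finset ι) {a b d : ι → ℝ}
    (ha0 : ∀ i ∈ s, 0 ≤ a i) (ha1 : ∀ i ∈ s, a i ≤ 1) (hb0 : ∀ i ∈ s, 0 ≤ b i)
    (hb1 : ∀ i ∈ s, b i ≤ 1) (hd : ∀ i ∈ s, 0 ≤ d i) (h : ∀ i ∈ s, a i ≤ b i + d i) :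
    ∏ i ∈ s, a i ≤ ∏ i ∈ s, b i + ∑ i ∈ s, d i := by
  classical
  induction s using Finset.induction_on with
  | empty => simp
  | insert j s hj ih =>
    simp only [Finset.forall_mem_insert] at *
    rw [Finset.prod_insert hj, Finset.prod_insert hj, Finset.sum_insert hj]
    have ih := ih ha0.2 ha1.2 hb0.2 hb1.2 hd.2 h.2
    have hP0 : 0 ≤ ∏ i ∈ s, b i := Finset.prod_nonneg hb0.2
    have hP1 : ∏ i ∈ s, b i ≤ 1 := Finset.prod_le_one hb0.2 hb1.2
    have hS : 0 ≤ ∑ i ∈ s, d i := Finset.sum_nonneg hd.2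
    calc a j * ∏ i ∈ s, a i
        ≤ a j * (∏ i ∈ s, b i + ∑ i ∈ s, d i) := mul_le_mul_of_nonneg_left ih ha0.1
      _ ≤ (b j + d j) * ∏ i ∈ s, b i + 1 * ∑ i ∈ s, d i := by
          rw [mul_add]
          exact add_le_add (mul_le_mul_of_nonneg_right h.1 hP0)
            (mul_le_mul_of_nonneg_right ha1.1 hS)
      _ ≤ _ := by nlinarith [mul_le_mul_of_nonneg_left hP1 hd.1]

lemma pow_le_pow_add_mul (n : ℕ) {a b d : ℝ} (ha0 : 0 ≤ a) (ha1 : a ≤ 1) (hb0 : 0 ≤ b)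
    (hb1 : b ≤ 1) (hd : 0 ≤ d) (h : a ≤ b + d) : a ^ n ≤ b ^ n + n * d := by
  simpa using prod_le_prod_add_sum (Finset.range n) (a := fun _ => a) (b := fun _ => b)
    (d := fun _ => d) (fun _ _ => ha0) (fun _ _ => ha1) (fun _ _ => hb0) (fun _ _ => hb1)
    (fun _ _ => hd) (fun _ _ => h)

/-- Below `1` the quadratic Taylor remainder is at most `x ^ θ`; above `1` the term `x ^ θ` absorbs
`x`. -/
lemma exp_neg_le_one_sub_add_rpow {θ x : ℝ} (h1 : 1 ≤ θ) (h2 : θ ≤ 2) (hx : 0 ≤ x) :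
    Real.exp (-x) ≤ 1 - x + x ^ θ := by
  rcases le_total x 1 with hx1 | hx1
  · have h := Real.abs_exp_sub_one_sub_id_le (x := -x) (by rw [abs_neg, abs_of_nonneg hx]; exact hx1)
    have h' := (abs_le.1 h).2
    have : x ^ 2 ≤ x ^ θ := by
      rcases hx.eq_or_lt with rfl | hx0
      · rw [Real.zero_rpow (by linarith)]; simp
      · rw [← Real.rpow_natCast]
        exact Real.rpow_le_rpow_of_exponent_ge hx0 hx1 (by simpa using h2)
    linarith [neg_sq x]
  · have : x ^ (1 : ℝ) ≤ x ^ θ := Real.rpow_le_rpow_of_exponent_le hx1 h1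
    rw [Real.rpow_one] at this
    have : Real.exp (-x) ≤ 1 := Real.exp_le_one_iff.2 (by linarith)
    linarith

lemma exp_neg_le_max_add_rpow {θ x : ℝ} (h1 : 1 ≤ θ) (h2 : θ ≤ 2) (hx : 0 ≤ x) :
    Real.exp (-x) ≤ max (1 - x) 0 + x ^ θ :=
  (exp_neg_le_one_sub_add_rpow h1 h2 hx).trans (by gcongr; exact le_max_left _ _)

lemma max_one_sub_le_exp_neg (x : ℝ) : max (1 - x) 0 ≤ Real.exp (-x) :=
  max_le (Real.one_sub_le_exp_neg x) (Real.exp_nonneg _)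

/-! ### Measurability and independence between generations -/

lemma measurable_S {Ω : Type*} [MeasurableSpace Ω] {k : ℕ} (q : ℝ) {W : Vertex k → Ω → ℝ}
    (hW : ∀ v, Measurable (W v)) (n : ℕ) (v : Gen k n) : Measurable (S q W n v) := by
  induction n with
  | zero => exact hW _
  | succ n ih => exact (ih (parent v)).add ((hW _).const_mul _)

lemma measurable_K {Ω : Type*} [MeasurableSpace Ω] {k : ℕ} (q : ℝ) {W : Vertex k → Ω → ℝ}
    (hW : ∀ v, Measurable (W v)) (n : ℕ) (v : Gen k n) : Measurable (K q W n v) :=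
  (measurable_S q hW n v).const_mul _

lemma aemeasurable_S {Ω : Type*} [MeasurableSpace Ω] {P : Measure Ω} {k : ℕ} (q : ℝ)
    {W : Vertex k → Ω → ℝ} (hW : ∀ v, AEMeasurable (W v) P) (n : ℕ) (v : Gen k n) :
    AEMeasurable (S q W n v) P := by
  induction n with
  | zero => exact hW _
  | succ n ih => exact (ih (parent v)).add ((hW _).const_mul _)

lemma aemeasurable_K {Ω : Type*} [MeasurableSpace Ω] {P : Measure Ω} {k : ℕ} (q : ℝ)
    {W : Vertex k → Ω → ℝ} (hW : ∀ v, AEMeasurable (W v) P) (n : ℕ) (v : Gen k n) :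
    AEMeasurable (K q W n v) P :=
  (aemeasurable_S q hW n v).const_mul _

/-- `S` up to generation `n` depends only on the variables up to generation `n`. -/
lemma S_congr {Ω Ω' : Type*} {k : ℕ} (q : ℝ) {W : Vertex k → Ω → ℝ} {W' : Vertex k → Ω' → ℝ}
    {ω : Ω} {ω' : Ω'} (n : ℕ) (h : ∀ v : Vertex k, v.1 ≤ n → W v ω = W' v ω') (v : Gen k n) :
    S q W n v ω = S q W' n v ω' := by
  induction n with
  | zero => exact h _ le_rfl
  | succ n ih =>
    simp only [S]
    rw [ih (fun v hv => h v (hv.trans n.le_succ)), h _ le_rfl]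

lemma K_nonneg {Ω : Type*} {k : ℕ} {q : ℝ} (hq : 0 ≤ q) {W : Vertex k → Ω → ℝ}
    {ω : Ω} (h : ∀ v, 0 ≤ W v ω) (n : ℕ) (v : Gen k n) : 0 ≤ K q W n v ω := by
  refine mul_nonneg (pow_nonneg hq _) ?_
  induction n with
  | zero => exact h _
  | succ n ih => exact add_nonneg (ih _) (mul_nonneg (inv_nonneg.2 (pow_nonneg hq _)) (h _))

section

variable {Ω : Type*} [MeasurableSpace Ω] {P : Measure Ω} {k : ℕ} {W : Vertex k → Ω → ℝ}

/-- The positions in generation `n` are independent of the variables in generation `n + 1`. -/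
lemma indepFun_K_succ (q : ℝ) (hW : ∀ v, AEMeasurable (W v) P) (hindep : iIndepFun W P) (n : ℕ) :
    IndepFun (fun ω (v : Gen k n) => K q W n v ω)
      (fun ω (w : Gen k (n + 1)) => W ⟨n + 1, w⟩ ω) P := by
  classical
  let A : Finset (Vertex k) := (Finset.range (n + 1)).sigma fun _ => Finset.univ
  let B : Finset (Vertex k) := ({n + 1} : Finset ℕ).sigma fun _ => Finset.univ
  have hA : ∀ v : Vertex k, v ∈ A ↔ v.1 ≤ n := fun v => by
    simp [A]
  have hB : ∀ v : Vertex k, v ∈ B ↔ v.1 = n + 1 := fun v => by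
    simp [B]
  have hAB : Disjoint A B := by
    rw [Finset.disjoint_left]
    intro v h1 h2
    rw [hA] at h1
    rw [hB] at h2
    omega
  have h := hindep.indepFun_finset₀ A B hAB hW
  -- Zero-filling the later generations makes `K` a measurable function of the coordinates in `A`;
  -- by `S_congr` the filler does not affect generation `n`.
  let W' : Vertex k → (A → ℝ) → ℝ := fun v x => if hv : v ∈ A then x ⟨v, hv⟩ else 0
  have hW' : ∀ v, Measurable (W' v) := fun v => by
    by_cases hv : v ∈ A
    · simpa [W', hv] using measurable_pi_apply _
    · simp [W', hv]
  have h' := h.comp (φ := fun x (v : Gen k n) => K q W' n v x)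
    (ψ := fun (y : B → ℝ) (w : Gen k (n + 1)) => y ⟨⟨n + 1, w⟩, (hB _).2 rfl⟩)
    (measurable_pi_lambda _ fun v => measurable_K q hW' n v)
    (measurable_pi_lambda _ fun w => measurable_pi_apply _)
  convert! h' using 1
  ext ω v
  simp only [K, Function.comp]
  congr 1
  refine S_congr q n (fun u hu => ?_) v
  simp [W', (hA u).2 hu]

/-! ### The transfer operator of one generation -/

/-- The operator `(T g)(y) = E [g (q y + W)]` for a standard exponential variable `W`. -/
noncomputable def transfer (q : ℝ) (g : ℝ → ℝ) (y : ℝ) : ℝ := ∫ w, g (q * y + w) ∂expMeasure 1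

lemma measurable_transfer (q : ℝ) {g : ℝ → ℝ} (hg : Measurable g) :
    Measurable (transfer q g) := by
  have h : StronglyMeasurable (Function.uncurry fun y w : ℝ => g (q * y + w)) :=
    (hg.comp (by fun_prop)).stronglyMeasurable
  exact (h.integral_prod_right (ν := expMeasure 1)).measurable

lemma transfer_nonneg (q : ℝ) {g : ℝ → ℝ} (h0 : ∀ y, 0 ≤ g y) (y : ℝ) : 0 ≤ transfer q g y :=
  integral_nonneg fun _ => h0 _

lemma integrable_of_mem_unit {α : Type*} [MeasurableSpace α] {μ : Measure α} [IsFiniteMeasure μ]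
    {g : α → ℝ} (hg : AEStronglyMeasurable g μ) (h0 : ∀ y, 0 ≤ g y) (h1 : ∀ y, g y ≤ 1) :
    Integrable g μ :=
  Integrable.of_bound hg 1 (ae_of_all _ fun y => by
    rw [Real.norm_of_nonneg (h0 y)]; exact h1 y)

lemma transfer_le_one (q : ℝ) {g : ℝ → ℝ} (hg : Measurable g) (h0 : ∀ y, 0 ≤ g y)
    (h1 : ∀ y, g y ≤ 1) (y : ℝ) : transfer q g y ≤ 1 := by
  have h := integral_mono (μ := expMeasure 1) (f := fun w => g (q * y + w)) (g := fun _ => (1 : ℝ))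
    (integrable_of_mem_unit (hg.comp (by fun_prop)).aestronglyMeasurable
      (fun _ => h0 _) (fun _ => h1 _)) (integrable_const _) (fun _ => h1 _)
  simpa [transfer] using h

lemma card_filter_parent (hk : 0 < k) (n : ℕ) (v : Gen k n) :
    (Finset.univ.filter fun w : Gen k (n + 1) => parent w = v).card = k := by
  have hlt : ∀ i : Fin k, v * k + i < k ^ (n + 1) := fun i => by
    have := v.2
    calc (v : ℕ) * k + i < v * k + k := by have := i.2; omega
      _ = (v + 1) * k := by ring
      _ ≤ k ^ n * k := Nat.mul_le_mul_right _ this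
      _ = _ := (pow_succ k n).symm
  have h : (Finset.univ.filter fun w : Gen k (n + 1) => parent w = v)
      = Finset.univ.image fun i : Fin k => (⟨v * k + i, hlt i⟩ : Gen k (n + 1)) := by
    ext w
    simp only [Finset.mem_filter, Finset.mem_univ, true_and, Finset.mem_image, parent, Fin.ext_iff]
    constructor
    · intro h
      refine ⟨⟨w % k, Nat.mod_lt _ hk⟩, ?_⟩
      rw [← h]
      exact Nat.div_add_mod' _ _
    · rintro ⟨i, hi⟩
      rw [← hi, mul_comm, Nat.mul_add_div hk, Nat.div_eq_of_lt i.2, add_zero]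
  rw [h, Finset.card_image_of_injective, Finset.card_univ, Fintype.card_fin]
  intro i j hij
  simpa [Fin.ext_iff] using hij

lemma prod_parent (hk : 0 < k) (n : ℕ) (f : Gen k n → ℝ) :
    ∏ w : Gen k (n + 1), f (parent w) = ∏ v, f v ^ k := by
  rw [← Finset.prod_fiberwise_of_maps_to (s := Finset.univ) (t := Finset.univ)
    (g := parent) (fun _ _ => Finset.mem_univ _)]
  refine Finset.prod_congr rfl fun v _ => ?_
  rw [Finset.prod_congr rfl (g := fun _ => f v), Finset.prod_const, card_filter_parent hk]
  intro w hw
  rw [(Finset.mem_filter.1 hw).2]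

/-- The product functional `E [∏_{|v| = n} g (K v)]` of generation `n`. -/
noncomputable def genProd (P : Measure Ω) (q : ℝ) (W : Vertex k → Ω → ℝ) (n : ℕ) (g : ℝ → ℝ) : ℝ :=
  ∫ ω, ∏ v : Gen k n, g (K q W n v ω) ∂P

/-- The branching property: averaging over the last generation. -/
lemma genProd_succ [IsProbabilityMeasure P] (hk : 0 < k) {q : ℝ} (hq : q ≠ 0)
    (hW : ∀ v, HasLaw (W v) (expMeasure 1) P) (hindep : iIndepFun W P) (n : ℕ)
    {g : ℝ → ℝ} (hg : Measurable g) (h0 : ∀ y, 0 ≤ g y) (h1 : ∀ y, g y ≤ 1) :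
    genProd P q W (n + 1) g = genProd P q W n fun y => transfer q g y ^ k := by
  have hWm : ∀ v, AEMeasurable (W v) P := fun v => (hW v).aemeasurable
  let X : Ω → Gen k n → ℝ := fun ω v => K q W n v ω
  let Y : Ω → Gen k (n + 1) → ℝ := fun ω w => W ⟨n + 1, w⟩ ω
  have hX : AEMeasurable X P := aemeasurable_pi_lambda _ fun v => aemeasurable_K q hWm n v
  have hY : HasLaw Y (Measure.pi fun _ => expMeasure 1) P :=
    iIndepFun.hasLaw_pi (fun w => hW ⟨n + 1, w⟩)
      (hindep.precomp (g := fun w : Gen k (n + 1) => (⟨n + 1, w⟩ : Vertex k))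
        sigma_mk_injective)
  have hXY := (indepFun_K_succ q hWm hindep n).map_prod_eq_prod_map_map hX hY.aemeasurable
  change P.map (fun ω => (X ω, Y ω)) = _ at hXY
  have : IsProbabilityMeasure (P.map X) := Measure.isProbabilityMeasure_map hX
  rw [hY.map_eq] at hXY
  let F : (Gen k n → ℝ) × (Gen k (n + 1) → ℝ) → ℝ := fun p => ∏ w, g (q * p.1 (parent w) + p.2 w)
  have hF : Measurable F := by
    refine Finset.measurable_prod _ fun w _ => hg.comp ?_
    fun_prop
  have hF0 : ∀ p, 0 ≤ F p := fun p => Finset.prod_nonneg fun _ _ => h0 _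
  have hF1 : ∀ p, F p ≤ 1 := fun p => Finset.prod_le_one (fun _ _ => h0 _) fun _ _ => h1 _
  have e1 : genProd P q W (n + 1) g = ∫ ω, F (X ω, Y ω) ∂P := by
    refine integral_congr_ae (ae_of_all _ fun ω => ?_)
    simp only [F, X, Y, K_succ hq]
  rw [e1, ← integral_map (f := F) (hX.prodMk hY.aemeasurable) hF.aestronglyMeasurable, hXY,
    integral_prod _ (integrable_of_mem_unit hF.aestronglyMeasurable hF0 hF1)]
  have e2 : ∀ x, ∫ y, F (x, y) ∂(Measure.pi fun _ => expMeasure 1)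
      = ∏ v, transfer q g (x v) ^ k := fun x => by
    simp only [F]
    rw [integral_fintype_prod_eq_prod (fun (w : Gen k (n + 1)) z => g (q * x (parent w) + z))]
    exact prod_parent hk n fun v => transfer q g (x v)
  simp only [e2]
  rw [integral_map hX]
  · rfl
  · refine (Finset.measurable_prod _ fun v _ => ?_).aestronglyMeasurable
    exact ((measurable_transfer q hg).comp (measurable_pi_apply v)).pow_const k

/-! ### Exponential moments -/

/-- The exponential moment `E [exp (a K(v))]`, `|v| = n`. -/
noncomputable def expMoment (q : ℝ) (n : ℕ) (a : ℝ) : ℝ :=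
  ∏ i ∈ Finset.range (n + 1), (1 - q ^ i * a)⁻¹

/-- By `K(w) = q K(v) + W w` the exponential splits into independent factors with parameters `q * a`
and `a`; hence the induction runs over all `a`. -/
lemma integral_exp_mul_K [IsProbabilityMeasure P] {q : ℝ} (hq0 : 0 < q) (hq1 : q < 1)
    (hW : ∀ v, HasLaw (W v) (expMeasure 1) P) (hindep : iIndepFun W P) (n : ℕ) (v : Gen k n)
    {a : ℝ} (ha0 : 0 ≤ a) (ha1 : a < 1) :
    Integrable (fun ω => Real.exp (a * K q W n v ω)) P ∧
      ∫ ω, Real.exp (a * K q W n v ω) ∂P = expMoment q n a := by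
  have hWm : ∀ v, AEMeasurable (W v) P := fun v => (hW v).aemeasurable
  have hexp : ∀ {a : ℝ}, a < 1 → ∀ v, Integrable (fun ω => Real.exp (a * W v ω)) P ∧
      ∫ ω, Real.exp (a * W v ω) ∂P = (1 - a)⁻¹ := fun {a} ha v => by
    refine ⟨?_, ?_⟩
    · have hi := integrable_exp_mul_expMeasure_one ha
      rw [← (hW v).map_eq, integrable_map_measure (by fun_prop) (hWm v)] at hi
      exact hi
    · rw [← integral_exp_mul_expMeasure_one ha, ← (hW v).integral_comp (by fun_prop)]
      rfl
  induction n generalizing a with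
  | zero =>
    simpa [K, S, expMoment] using hexp ha1 ⟨0, v⟩
  | succ n ih =>
    have hqa : q * a < 1 := by nlinarith
    have ih := ih (parent v) (mul_nonneg hq0.le ha0) hqa
    have hind : IndepFun (fun ω => Real.exp (q * a * K q W n (parent v) ω))
        (fun ω => Real.exp (a * W ⟨n + 1, v⟩ ω)) P :=
      (indepFun_K_succ q hWm hindep n).comp
        (φ := fun x : Gen k n → ℝ => Real.exp (q * a * x (parent v)))
        (ψ := fun y : Gen k (n + 1) → ℝ => Real.exp (a * y v))
        (by fun_prop) (by fun_prop)
    have e : ∀ ω, Real.exp (a * K q W (n + 1) v ω)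
        = Real.exp (q * a * K q W n (parent v) ω) * Real.exp (a * W ⟨n + 1, v⟩ ω) := fun ω => by
      rw [K_succ hq0.ne', ← Real.exp_add]
      ring_nf
    simp only [e]
    refine ⟨hind.integrable_mul ih.1 (hexp ha1 _).1, ?_⟩
    rw [hind.integral_fun_mul_eq_mul_integral ih.1.aestronglyMeasurable
      (hexp ha1 _).1.aestronglyMeasurable, ih.2, (hexp ha1 _).2, expMoment, expMoment,
      Finset.prod_range_succ' _ (n + 1)]
    simp [pow_succ, mul_assoc]

end

/-! ### Laplace functionals of the generations -/

lemma expMoment_factor_pos {q a : ℝ} (hq0 : 0 < q) (hq1 : q < 1) (ha0 : 0 ≤ a) (ha1 : a < 1)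
    (i : ℕ) : 0 < 1 - q ^ i * a := by
  have : q ^ i ≤ 1 := pow_le_one₀ hq0.le hq1.le
  nlinarith [pow_nonneg hq0.le i]

lemma expMoment_nonneg {q a : ℝ} (hq0 : 0 < q) (hq1 : q < 1) (ha0 : 0 ≤ a) (ha1 : a < 1) (n : ℕ) :
    0 ≤ expMoment q n a :=
  Finset.prod_nonneg fun i _ => inv_nonneg.2 (expMoment_factor_pos hq0 hq1 ha0 ha1 i).le

lemma phiInf_le_prod {q : ℝ} (hq0 : 0 < q) (hq1 : q < 1) (n : ℕ) :
    phiInf q ≤ ∏ j ∈ Finset.range n, (1 - q ^ (j + 1)) := by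
  refine Antitone.le_of_tendsto (antitone_nat_of_succ_le fun m => ?_) (tendsto_phiInf hq0 hq1) n
  have h : ∀ j : ℕ, 0 ≤ 1 - q ^ (j + 1) := fun j => sub_nonneg.2 (pow_le_one₀ hq0.le hq1.le)
  rw [Finset.prod_range_succ]
  exact mul_le_of_le_one_right (Finset.prod_nonneg fun j _ => h j)
    (by linarith [pow_nonneg hq0.le (m + 1)])

/-- Uniformity in `n` is the point: only the factor `i = 0` depends critically on `a`, and the
others are compared with `a = 1`. -/
lemma expMoment_le {q a : ℝ} (hq0 : 0 < q) (hq1 : q < 1) (ha1 : a < 1) (n : ℕ) :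
    expMoment q n a ≤ ((1 - a) * phiInf q)⁻¹ := by
  rw [expMoment, Finset.prod_inv_distrib, Finset.prod_range_succ', pow_zero, one_mul,
    mul_comm (1 - a)]
  have ha : 0 < 1 - a := by linarith
  refine inv_anti₀ (mul_pos (phiInf_pos hq0 hq1) ha) (mul_le_mul_of_nonneg_right ?_ ha.le)
  refine (phiInf_le_prod hq0 hq1 n).trans (Finset.prod_le_prod (fun j _ => ?_) fun j _ => ?_)
  · exact sub_nonneg.2 (pow_le_one₀ hq0.le hq1.le)
  · nlinarith [pow_nonneg hq0.le (j + 1)]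

lemma tendsto_prod_inv_phiInf {q : ℝ} (hq0 : 0 < q) (hq1 : q < 1) :
    Tendsto (fun n : ℕ => ∏ i ∈ Finset.range n, (1 - q ^ i * q)⁻¹) atTop (𝓝 (phiInf q)⁻¹) := by
  simpa [pow_succ, Finset.prod_inv_distrib] using
    (tendsto_phiInf hq0 hq1).inv₀ (phiInf_pos hq0 hq1).ne'

/-- To first order `exp(aW)` may be replaced by its mean `(1 - a)⁻¹`; the error is its moment of
order `θ`, equal to `(1 - θ a)⁻¹`. -/
lemma transfer_exp_neg_exp_le {q a θ l : ℝ} (h1 : 1 ≤ θ) (h2 : θ ≤ 2) (ha0 : 0 ≤ a)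
    (ha1 : θ * a < 1) (hl : 0 ≤ l) (y : ℝ) :
    transfer q (fun y => Real.exp (-(l * Real.exp (a * y)))) y ≤
      Real.exp (-(l * (1 - a)⁻¹ * Real.exp (a * q * y))) +
        l ^ θ * (1 - θ * a)⁻¹ * Real.exp (θ * (a * q) * y) := by
  have ha : a < 1 := by nlinarith
  have hpt : ∀ w, Real.exp (-(l * Real.exp (a * (q * y + w)))) ≤
      1 - l * Real.exp (a * q * y) * Real.exp (a * w) +
        l ^ θ * Real.exp (θ * (a * q) * y) * Real.exp (θ * a * w) := fun w => by
    refine (exp_neg_le_one_sub_add_rpow h1 h2 (by positivity)).trans (le_of_eq ?_)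
    have e₁ : Real.exp (a * (q * y + w)) = Real.exp (a * q * y) * Real.exp (a * w) := by
      rw [← Real.exp_add]; ring_nf
    have e₂ : Real.exp (a * (q * y + w)) ^ θ =
        Real.exp (θ * (a * q) * y) * Real.exp (θ * a * w) := by
      rw [← Real.exp_mul, ← Real.exp_add]; ring_nf
    rw [Real.mul_rpow hl (Real.exp_nonneg _), e₂, e₁]
    ring
  have i1 := integrable_exp_mul_expMeasure_one ha
  have i2 := integrable_exp_mul_expMeasure_one ha1
  have i3 := (integrable_const (μ := expMeasure 1) (1 : ℝ)).sub
    (i1.const_mul (l * Real.exp (a * q * y)))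
  have i4 := i2.const_mul (l ^ θ * Real.exp (θ * (a * q) * y))
  refine (integral_mono (μ := expMeasure 1) (integrable_of_mem_unit
      (by fun_prop) (fun w => Real.exp_nonneg _)
      (fun w => Real.exp_le_one_iff.2 (neg_nonpos.2 (by positivity)))) (i3.add i4) hpt).trans ?_
  rw [integral_add' i3 i4, integral_sub' (integrable_const _) (i1.const_mul _),
    integral_const_mul, integral_const_mul,
    integral_exp_mul_expMeasure_one ha, integral_exp_mul_expMeasure_one ha1]
  -- Folds the linear term, now averaged, back into an exponential.
  have := Real.one_sub_le_exp_neg (l * (1 - a)⁻¹ * Real.exp (a * q * y))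
  simp only [integral_const, probReal_univ, one_smul]
  linarith

section

variable {Ω : Type*} [MeasurableSpace Ω] {P : Measure Ω} {k : ℕ} {W : Vertex k → Ω → ℝ}
  {q : ℝ}

lemma ae_K_nonneg (hq : 0 ≤ q) (hW : ∀ v, HasLaw (W v) (expMeasure 1) P) (n : ℕ) :
    ∀ᵐ ω ∂P, ∀ v : Gen k n, 0 ≤ K q W n v ω := by
  have h : ∀ᵐ ω ∂P, ∀ v, 0 ≤ W v ω := ae_all_iff.2 fun v =>
    ((hW v).ae_iff (p := fun x => 0 ≤ x) (measurableSet_setOfPred.1 measurableSet_Ici)).2 ae_nonneg_expMeasure_one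
  filter_upwards [h] with ω hω v using K_nonneg hq hω n v

variable [IsProbabilityMeasure P]

lemma integrable_prod_K (hW : ∀ v, AEMeasurable (W v) P) (n : ℕ) {g : ℝ → ℝ} (hg : Measurable g)
    (h0 : ∀ y, 0 ≤ g y) (h1 : ∀ y, g y ≤ 1) :
    Integrable (fun ω => ∏ v : Gen k n, g (K q W n v ω)) P :=
  integrable_of_mem_unit
    (Finset.aemeasurable_fun_prod _ fun v _ =>
      hg.comp_aemeasurable (aemeasurable_K q hW n v)).aestronglyMeasurable
    (fun _ => Finset.prod_nonneg fun _ _ => h0 _)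
    (fun _ => Finset.prod_le_one (fun _ _ => h0 _) fun _ _ => h1 _)

/-- The errors add over the `k ^ n` vertices, and their expectation needs only the one-vertex
moment; the dependence between vertices plays no role. -/
lemma genProd_le_add (hq0 : 0 < q) (hq1 : q < 1) (hW : ∀ v, HasLaw (W v) (expMeasure 1) P)
    (hindep : iIndepFun W P) (n : ℕ) {g₁ g₂ : ℝ → ℝ} (hg₁ : Measurable g₁) (hg₂ : Measurable g₂)
    (h₁0 : ∀ y, 0 ≤ g₁ y) (h₁1 : ∀ y, g₁ y ≤ 1) (h₂0 : ∀ y, 0 ≤ g₂ y) (h₂1 : ∀ y, g₂ y ≤ 1)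
    {C b : ℝ} (hC : 0 ≤ C) (hb0 : 0 ≤ b) (hb1 : b < 1)
    (h : ∀ y, g₁ y ≤ g₂ y + C * Real.exp (b * y)) :
    genProd P q W n g₁ ≤ genProd P q W n g₂ + (k : ℝ) ^ n * C * expMoment q n b := by
  have hWm : ∀ v, AEMeasurable (W v) P := fun v => (hW v).aemeasurable
  have hi : ∀ v ∈ (Finset.univ : Finset (Gen k n)),
      Integrable (fun ω => C * Real.exp (b * K q W n v ω)) P := fun v _ =>
    (integral_exp_mul_K hq0 hq1 hW hindep n v hb0 hb1).1.const_mul C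
  have hint := integral_mono (integrable_prod_K hWm n hg₁ h₁0 h₁1)
    ((integrable_prod_K (q := q) hWm n hg₂ h₂0 h₂1).add (integrable_finsetSum _ hi)) fun ω =>
      prod_le_prod_add_sum Finset.univ (fun v _ => h₁0 (K q W n v ω)) (fun _ _ => h₁1 _)
        (fun _ _ => h₂0 _) (fun _ _ => h₂1 _)
        (fun _ _ => mul_nonneg hC (Real.exp_nonneg _)) fun v _ => h (K q W n v ω)
  refine hint.trans (le_of_eq ?_)
  simp only [Pi.add_apply]
  rw [integral_add (integrable_prod_K hWm n hg₂ h₂0 h₂1) (integrable_finsetSum _ hi),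
    integral_finsetSum _ hi]
  simp only [integral_const_mul, (integral_exp_mul_K hq0 hq1 hW hindep n _ hb0 hb1).2]
  simp [genProd, mul_assoc]

/-- The Laplace functional `E [exp (-L k⁻ⁿ ∑_{|v| = n} exp (a K(v)))]`. -/
noncomputable def laplace (P : Measure Ω) (q : ℝ) (W : Vertex k → Ω → ℝ) (n : ℕ) (L a : ℝ) : ℝ :=
  genProd P q W n fun y => Real.exp (-(L / (k : ℝ) ^ n * Real.exp (a * y)))

/-- Almost surely `K ≥ 0`, so the average of `exp(a K(v))` is at least `1`. -/
lemma laplace_le (hk : 0 < k) (hq0 : 0 < q) (hW : ∀ v, HasLaw (W v) (expMeasure 1) P) (n : ℕ)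
    {L a : ℝ} (hL : 0 ≤ L) (ha : 0 ≤ a) : laplace P q W n L a ≤ Real.exp (-L) := by
  have hWm : ∀ v, AEMeasurable (W v) P := fun v => (hW v).aemeasurable
  have hk' : (k : ℝ) ^ n ≠ 0 := pow_ne_zero _ (by exact_mod_cast hk.ne')
  have h := integral_mono_ae (μ := P) (g := fun _ => Real.exp (-L))
    (integrable_prod_K hWm n (g := fun y => Real.exp (-(L / (k : ℝ) ^ n * Real.exp (a * y))))
      (by fun_prop) (fun _ => Real.exp_nonneg _)
      (fun y => Real.exp_le_one_iff.2 (neg_nonpos.2 (by positivity)))) (integrable_const _) (by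
    filter_upwards [ae_K_nonneg hq0.le hW n] with ω hω
    calc ∏ v : Gen k n, Real.exp (-(L / (k : ℝ) ^ n * Real.exp (a * K q W n v ω)))
        ≤ ∏ v : Gen k n, Real.exp (-(L / (k : ℝ) ^ n)) := by
          refine Finset.prod_le_prod (fun _ _ => Real.exp_nonneg _) fun v _ => ?_
          refine Real.exp_le_exp.2 (neg_le_neg (le_mul_of_one_le_right (by positivity) ?_))
          exact Real.one_le_exp (mul_nonneg ha (hω v))
      _ = Real.exp (-L) := by
          rw [Finset.prod_const, Finset.card_univ, Fintype.card_fin, ← Real.exp_nat_mul]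
          congr 1
          push_cast
          field_simp)
  simpa [laplace, genProd] using h

lemma le_laplace (hk : 0 < k) (hq0 : 0 < q) (hq1 : q < 1)
    (hW : ∀ v, HasLaw (W v) (expMeasure 1) P) (hindep : iIndepFun W P) (n : ℕ)
    {L a : ℝ} (hL : 0 ≤ L) (ha0 : 0 ≤ a) (ha1 : a < 1) :
    Real.exp (-(L * expMoment q n a)) ≤ laplace P q W n L a := by
  have hWm : ∀ v, AEMeasurable (W v) P := fun v => (hW v).aemeasurable
  have hk' : (k : ℝ) ^ n ≠ 0 := pow_ne_zero _ (by exact_mod_cast hk.ne')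
  have hi : ∀ v ∈ (Finset.univ : Finset (Gen k n)),
      Integrable (fun ω => -(L / (k : ℝ) ^ n * Real.exp (a * K q W n v ω))) P := fun v _ =>
    ((integral_exp_mul_K hq0 hq1 hW hindep n v ha0 ha1).1.const_mul _).neg
  have hprod := integrable_prod_K (q := q) hWm n
    (g := fun y => Real.exp (-(L / (k : ℝ) ^ n * Real.exp (a * y))))
    (by fun_prop) (fun _ => Real.exp_nonneg _)
    (fun y => Real.exp_le_one_iff.2 (neg_nonpos.2 (by positivity)))
  simp only [← Real.exp_sum] at hprod
  -- Jensen's inequality for `exp`, applied to the total exponent.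
  have h := convexOn_exp.map_integral_le Real.continuous_exp.continuousOn isClosed_univ
    (ae_of_all _ fun _ => Set.mem_univ _) (integrable_finsetSum _ hi) hprod
  rw [integral_finsetSum _ hi] at h
  simp only [integral_neg, integral_const_mul,
    (integral_exp_mul_K hq0 hq1 hW hindep n _ ha0 ha1).2] at h
  rw [laplace, genProd]
  simp only [← Real.exp_sum]
  refine (le_of_eq ?_).trans h
  congr 1
  rw [Finset.sum_const, Finset.card_univ, Fintype.card_fin, nsmul_eq_mul]
  push_cast
  field_simp

lemma tendsto_error (hk : 2 ≤ k) (hq0 : 0 < q) (hq1 : q < 1) {θ b : ℝ} (hθ : 1 < θ)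
    (hb0 : 0 ≤ b) (hb1 : b < 1) {L : ℝ} (hL : 0 ≤ L) (C : ℝ) :
    Tendsto (fun n : ℕ => (k : ℝ) ^ n * (C * (L / (k : ℝ) ^ (n + 1)) ^ θ) * expMoment q n b)
      atTop (𝓝 0) := by
  have hk' : (1 : ℝ) < k := by exact_mod_cast (by omega : 1 < k)
  have hk0 : (0 : ℝ) < k := by linarith
  -- Against the `k ^ n` vertices, the power `θ` leaves a geometric sequence of ratio `k ^ (1 - θ) <
  -- 1`.
  have e : ∀ n : ℕ, (k : ℝ) ^ n * (C * (L / (k : ℝ) ^ (n + 1)) ^ θ)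
      = C * L ^ θ * (k : ℝ) ^ (-θ) * ((k : ℝ) ^ (1 - θ)) ^ n := fun n => by
    rw [Real.div_rpow hL (by positivity), ← Real.rpow_natCast (k : ℝ) (n + 1),
      ← Real.rpow_natCast (k : ℝ) n, ← Real.rpow_natCast ((k : ℝ) ^ (1 - θ)),
      ← Real.rpow_mul hk0.le, ← Real.rpow_mul hk0.le, div_eq_mul_inv, ← Real.rpow_neg hk0.le,
      mul_assoc (C * L ^ θ), ← Real.rpow_add hk0]
    have : (k : ℝ) ^ (-θ + (1 - θ) * n) = (k : ℝ) ^ (n : ℝ) * (k : ℝ) ^ (-(((n + 1 : ℕ) : ℝ) * θ)) := by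
      rw [← Real.rpow_add hk0]
      push_cast
      ring_nf
    rw [this]
    ring
  have hr : (k : ℝ) ^ (1 - θ) < 1 := Real.rpow_lt_one_of_one_lt_of_neg hk' (by linarith)
  have ht : Tendsto (fun n : ℕ => (k : ℝ) ^ n * (C * (L / (k : ℝ) ^ (n + 1)) ^ θ)) atTop (𝓝 0) := by
    simp only [e]
    simpa using (tendsto_pow_atTop_nhds_zero_of_lt_one (by positivity) hr).const_mul
      (C * L ^ θ * (k : ℝ) ^ (-θ))
  refine ht.zero_mul_isBoundedUnder_le (isBoundedUnder_of ⟨((1 - b) * phiInf q)⁻¹, fun n => ?_⟩)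
  rw [Function.comp_apply, Real.norm_of_nonneg (expMoment_nonneg hq0 hq1 hb0 hb1 n)]
  exact expMoment_le hq0 hq1 hb1 n

lemma laplace_succ_le (hk : 0 < k) (hq0 : 0 < q) (hq1 : q < 1)
    (hW : ∀ v, HasLaw (W v) (expMeasure 1) P) (hindep : iIndepFun W P) (n : ℕ)
    {L a θ : ℝ} (h1 : 1 ≤ θ) (h2 : θ ≤ 2) (hL : 0 ≤ L) (ha0 : 0 ≤ a) (ha1 : θ * a < 1) :
    laplace P q W (n + 1) L a ≤ laplace P q W n (L * (1 - a)⁻¹) (a * q) +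
      (k : ℝ) ^ n * (k * (1 - θ * a)⁻¹ * (L / (k : ℝ) ^ (n + 1)) ^ θ) *
        expMoment q n (θ * (a * q)) := by
  have hk0 : (0 : ℝ) < k := by exact_mod_cast hk
  have ha : 0 < 1 - a := by nlinarith
  have haθ : 0 < 1 - θ * a := by linarith
  set l : ℝ := L / (k : ℝ) ^ (n + 1) with hl
  have hl0 : 0 ≤ l := by positivity
  have hg : Measurable fun y => Real.exp (-(l * Real.exp (a * y))) := by fun_prop
  have hg0 : ∀ y, 0 ≤ Real.exp (-(l * Real.exp (a * y))) := fun _ => Real.exp_nonneg _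
  have hg1 : ∀ y, Real.exp (-(l * Real.exp (a * y))) ≤ 1 := fun y =>
    Real.exp_le_one_iff.2 (neg_nonpos.2 (by positivity))
  have hT0 := transfer_nonneg q hg0
  have hT1 := transfer_le_one q hg hg0 hg1
  have e : ∀ y, Real.exp (-(L * (1 - a)⁻¹ / (k : ℝ) ^ n * Real.exp (a * q * y)))
      = Real.exp (-(l * (1 - a)⁻¹ * Real.exp (a * q * y))) ^ k := fun y => by
    rw [← Real.exp_nat_mul, hl, pow_succ]
    congr 1
    field_simp
  rw [laplace, genProd_succ hk hq0.ne' hW hindep n hg hg0 hg1]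
  refine genProd_le_add hq0 hq1 hW hindep n ((measurable_transfer q hg).pow_const k)
    (by fun_prop) (fun y => pow_nonneg (hT0 y) _) (fun y => pow_le_one₀ (hT0 y) (hT1 y))
    (fun y => Real.exp_nonneg _)
    (fun y => Real.exp_le_one_iff.2 (neg_nonpos.2 (by positivity)))
    (by positivity) (by positivity) (by nlinarith [mul_nonneg (by linarith : 0 ≤ θ) ha0])
    fun y => ?_
  rw [e]
  refine (pow_le_pow_add_mul k (hT0 y) (hT1 y) (Real.exp_nonneg _)
    (Real.exp_le_one_iff.2 (neg_nonpos.2 (by positivity))) (by positivity)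
    (transfer_exp_neg_exp_le h1 h2 ha0 ha1 hl0 y)).trans (le_of_eq ?_)
  ring

/-- `J` is fixed while `n` grows, so only finitely many one-step errors accumulate, each tending to
`0`. -/
lemma eventually_laplace_le (hk : 2 ≤ k) (hq0 : 0 < q) (hq1 : q < 1)
    (hW : ∀ v, HasLaw (W v) (expMeasure 1) P) (hindep : iIndepFun W P)
    {θ : ℝ} (h1 : 1 < θ) (h2 : θ ≤ 2) (J : ℕ) {L a : ℝ} (hL : 0 ≤ L) (ha0 : 0 ≤ a)
    (ha1 : θ * a < 1) {ε : ℝ} (hε : 0 < ε) :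
    ∀ᶠ n in atTop, laplace P q W n L a ≤
      Real.exp (-(L * ∏ i ∈ Finset.range J, (1 - q ^ i * a)⁻¹)) + ε := by
  induction J generalizing L a ε with
  | zero =>
    refine Eventually.of_forall fun n => ?_
    simpa using (laplace_le (by omega) hq0 hW n hL ha0).trans (by linarith)
  | succ J ih =>
    have ha : 0 < 1 - a := by nlinarith
    have hθa : 0 ≤ θ * a := by positivity
    have hb1 : θ * (a * q) < 1 := by nlinarith
    have hL' : 0 ≤ L * (1 - a)⁻¹ := by positivity
    have hih := ih hL' (by positivity : 0 ≤ a * q) hb1 (half_pos hε)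
    have herr := (tendsto_error hk hq0 hq1 h1 (b := θ * (a * q)) (by positivity) hb1 hL
      (k * (1 - θ * a)⁻¹)).eventually (gt_mem_nhds (half_pos hε))
    rw [← map_add_atTop_eq_nat 1, eventually_map]
    filter_upwards [hih, herr] with n hn hn'
    have hs := laplace_succ_le (by omega) hq0 hq1 hW hindep n h1.le h2 hL ha0 ha1
    -- The factor `i = 0` is the one produced by this step; the others are those of the parameter `a
    -- * q`.
    have e : L * ∏ i ∈ Finset.range (J + 1), (1 - q ^ i * a)⁻¹
        = L * (1 - a)⁻¹ * ∏ i ∈ Finset.range J, (1 - q ^ i * (a * q))⁻¹ := by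
      rw [Finset.prod_range_succ', pow_zero, one_mul, mul_assoc, mul_comm (1 - a)⁻¹]
      simp only [pow_succ, mul_assoc, mul_comm a q]
    rw [e]
    linarith

lemma tendsto_laplace (hk : 2 ≤ k) (hq0 : 0 < q) (hq1 : q < 1)
    (hW : ∀ v, HasLaw (W v) (expMeasure 1) P) (hindep : iIndepFun W P) {L : ℝ} (hL : 0 ≤ L)
    {θ : ℝ} (h1 : 1 < θ) (h2 : θ ≤ 2) (hθ : θ * q < 1) :
    Tendsto (fun n => laplace P q W n L q) atTop (𝓝 (Real.exp (-(L / phiInf q)))) := by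
  have hc : Tendsto (fun n : ℕ => Real.exp (-(L * ∏ i ∈ Finset.range n, (1 - q ^ i * q)⁻¹))) atTop
      (𝓝 (Real.exp (-(L / phiInf q)))) :=
    (Real.continuous_exp.tendsto _).comp ((tendsto_prod_inv_phiInf hq0 hq1).const_mul L).neg
  refine tendsto_order.2 ⟨fun c hlt => ?_, fun c hlt => ?_⟩
  -- The shift by one is needed because `expMoment q n` has `n + 1` factors.
  · filter_upwards [((tendsto_add_atTop_iff_nat 1).2 hc).eventually (lt_mem_nhds hlt)] with n hn
    exact hn.trans_le (le_laplace (by omega) hq0 hq1 hW hindep n hL hq0.le hq1)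
  · obtain ⟨J, hJ⟩ := (hc.eventually (gt_mem_nhds hlt)).exists
    filter_upwards [eventually_laplace_le hk hq0 hq1 hW hindep h1 h2 J hL hq0.le hθ
      (half_pos (sub_pos.2 hJ))] with n hn
    linarith

end

/-! ### The distribution function of the maximum -/

section

variable {Ω : Type*} {k : ℕ} {W : Vertex k → Ω → ℝ} {q : ℝ}

lemma setOf_tau_le (hk : 0 < k) (n : ℕ) (s : ℝ) :
    {ω | tau q W n ω ≤ s} = {ω | ∀ v : Gen k n, K q W n v ω ≤ s + Real.log k * n} := by
  ext ω
  have h := isGreatest_Kmax hk q W n ω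
  rw [Set.mem_ofPred_eq, Set.mem_ofPred_eq, tau, sub_le_iff_le_add,
    isLUB_le_iff h.isLUB, mem_upperBounds, Set.forall_mem_range]

variable [MeasurableSpace Ω] {P : Measure Ω}

lemma aemeasurable_tau (hW : ∀ v, AEMeasurable (W v) P) (n : ℕ) :
    AEMeasurable (tau q W n) P :=
  (AEMeasurable.iSup fun v => aemeasurable_K q hW n v).sub_const _

lemma measureReal_tau_le (hk : 0 < k) (hW : ∀ v, AEMeasurable (W v) P) (n : ℕ) (s : ℝ) :
    P.real {ω | tau q W n ω ≤ s} =
      genProd P q W n ((Set.Iic (s + Real.log k * n)).indicator fun _ => 1) := by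
  rw [setOf_tau_le hk]
  have hm : NullMeasurableSet
      {ω | ∀ v : Gen k n, K q W n v ω ≤ s + Real.log k * n} P := by
    rw [Set.ofPred_forall]
    exact NullMeasurableSet.iInter fun v =>
      nullMeasurableSet_le (aemeasurable_K q hW n v) aemeasurable_const
  rw [genProd, ← mul_one (P.real _), ← smul_eq_mul, ← setIntegral_const (1 : ℝ),
    ← integral_indicator₀ hm]
  congr 1
  ext ω
  by_cases h : ∀ v : Gen k n, K q W n v ω ≤ s + Real.log k * n
  · simp [Set.indicator, h]
  · rw [Set.indicator_of_notMem (by exact h)]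
    obtain ⟨v, hv⟩ := not_forall.1 h
    exact (Finset.prod_eq_zero (Finset.mem_univ v) (Set.indicator_of_notMem (by exact hv) _)).symm

variable [IsProbabilityMeasure P]

lemma transfer_indicator_Iic (x y : ℝ) :
    transfer q ((Set.Iic x).indicator fun _ => 1) y =
      max (1 - Real.exp (-x) * Real.exp (q * y)) 0 := by
  have e : ∀ w, (Set.Iic x).indicator (fun _ => (1 : ℝ)) (q * y + w)
      = (Set.Iic (x - q * y)).indicator 1 w := fun w => by
    simp [Set.indicator, le_sub_iff_add_le']
  simp only [transfer, e]
  rw [integral_indicator_one measurableSet_Iic, expMeasure_one_real_Iic, ← Real.exp_add]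
  ring_nf

/-- The distribution function of `τ_{n+1}` is asymptotically a Laplace functional of
generation `n`. -/
lemma tau_succ_laplace_bounds (hk : 0 < k) (hq0 : 0 < q) (hq1 : q < 1)
    (hW : ∀ v, HasLaw (W v) (expMeasure 1) P) (hindep : iIndepFun W P)
    {θ : ℝ} (h1 : 1 ≤ θ) (h2 : θ ≤ 2) (hθ : θ * q < 1) (s : ℝ) (n : ℕ) :
    P.real {ω | tau q W (n + 1) ω ≤ s} ≤ laplace P q W n (Real.exp (-s)) q ∧
    laplace P q W n (Real.exp (-s)) q ≤ P.real {ω | tau q W (n + 1) ω ≤ s} +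
      (k : ℝ) ^ n * (k * (Real.exp (-s) / (k : ℝ) ^ (n + 1)) ^ θ) * expMoment q n (θ * q) := by
  have hk0 : (0 : ℝ) < k := by exact_mod_cast hk
  -- The centring by `log k` exactly cancels the number of vertices.
  have hl : Real.exp (-(s + Real.log k * (n + 1 : ℕ))) = Real.exp (-s) / (k : ℝ) ^ (n + 1) := by
    rw [neg_add, Real.exp_add, Real.exp_neg (Real.log k * _), Real.exp_mul, Real.exp_log hk0,
      Real.rpow_natCast, div_eq_mul_inv]
  rw [measureReal_tau_le hk (fun v => (hW v).aemeasurable),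
    genProd_succ hk hq0.ne' hW hindep n (measurable_const.indicator measurableSet_Iic)
      (fun y => Set.indicator_nonneg (fun _ _ => zero_le_one) y)
      (fun y => Set.indicator_le_self' (fun _ _ => zero_le_one) y)]
  simp only [transfer_indicator_Iic, hl]
  set l : ℝ := Real.exp (-s) / (k : ℝ) ^ (n + 1) with hl_def
  have hl0 : 0 ≤ l := by positivity
  have ha : ∀ y, 0 ≤ l * Real.exp (q * y) := fun y => by positivity
  have e : ∀ y, Real.exp (-(Real.exp (-s) / (k : ℝ) ^ n * Real.exp (q * y)))
      = Real.exp (-(l * Real.exp (q * y))) ^ k := fun y => by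
    rw [← Real.exp_nat_mul, hl_def, pow_succ]
    congr 1
    field_simp
  have m1 : Measurable fun y => max (1 - l * Real.exp (q * y)) 0 ^ k := by fun_prop
  have m2 : Measurable fun y => Real.exp (-(Real.exp (-s) / (k : ℝ) ^ n * Real.exp (q * y))) := by
    fun_prop
  have b0 : ∀ y, 0 ≤ max (1 - l * Real.exp (q * y)) 0 := fun y => le_max_right _ _
  have b1 : ∀ y, max (1 - l * Real.exp (q * y)) 0 ≤ 1 := fun y =>
    max_le (by linarith [ha y]) zero_le_one
  have c1 : ∀ y, Real.exp (-(Real.exp (-s) / (k : ℝ) ^ n * Real.exp (q * y))) ≤ 1 := fun y =>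
    Real.exp_le_one_iff.2 (neg_nonpos.2 (by positivity))
  have hθ0 : 0 ≤ θ := by linarith
  constructor
  -- This direction has no error (`C = 0`), since `(1 - x)₊ ≤ exp(-x)`.
  · have h := genProd_le_add hq0 hq1 hW hindep n m1 m2 (fun y => pow_nonneg (b0 y) k)
      (fun y => pow_le_one₀ (b0 y) (b1 y)) (fun y => Real.exp_nonneg _) c1 le_rfl hq0.le hq1
      fun y => by
        rw [e, zero_mul, add_zero]
        exact pow_le_pow_left₀ (b0 y) (max_one_sub_le_exp_neg _) k
    simpa [laplace] using h
  · refine genProd_le_add hq0 hq1 hW hindep n m2 m1 (fun y => Real.exp_nonneg _) c1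
      (fun y => pow_nonneg (b0 y) k) (fun y => pow_le_one₀ (b0 y) (b1 y)) (by positivity)
      (by positivity) hθ fun y => ?_
    rw [e]
    refine (pow_le_pow_add_mul k (Real.exp_nonneg _)
      (Real.exp_le_one_iff.2 (neg_nonpos.2 (ha y))) (b0 y) (b1 y)
      (Real.rpow_nonneg (ha y) θ) (exp_neg_le_max_add_rpow h1 h2 (ha y))).trans (le_of_eq ?_)
    rw [Real.mul_rpow hl0 (Real.exp_nonneg _), ← Real.exp_mul]
    ring_nf

lemma exists_exponent (hq0 : 0 < q) (hq1 : q < 1) : ∃ θ : ℝ, 1 < θ ∧ θ ≤ 2 ∧ θ * q < 1 := by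
  -- The midpoint of `1` and `1/q`, capped at `2`.
  refine ⟨min 2 ((1 + q⁻¹) / 2), lt_min one_lt_two ?_, min_le_left _ _, ?_⟩
  · linarith [(one_lt_inv₀ hq0).2 hq1]
  · refine (mul_le_mul_of_nonneg_right (min_le_right _ _) hq0.le).trans_lt ?_
    field_simp
    linarith

lemma tendsto_measureReal_tau_le (hk : 2 ≤ k) (hq0 : 0 < q) (hq1 : q < 1)
    (hW : ∀ v, HasLaw (W v) (expMeasure 1) P) (hindep : iIndepFun W P) (s : ℝ) :
    Tendsto (fun n : ℕ => P.real {ω | tau q W n ω ≤ s}) atTop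
      (𝓝 (Real.exp (-(Real.exp (-s) / phiInf q)))) := by
  obtain ⟨θ, h1, h2, hθ⟩ := exists_exponent hq0 hq1
  rw [← tendsto_add_atTop_iff_nat 1]
  have hL := tendsto_laplace hk hq0 hq1 hW hindep (Real.exp_nonneg (-s)) h1 h2 hθ
  have hE := tendsto_error hk hq0 hq1 h1 (b := θ * q) (by positivity) hθ
    (Real.exp_nonneg (-s)) (k : ℝ)
  have hb := tau_succ_laplace_bounds (by omega) hq0 hq1 hW hindep h1.le h2 hθ s
  refine tendsto_of_tendsto_of_tendsto_of_le_of_le (by simpa using hL.sub hE) hL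
    (fun n => ?_) fun n => (hb n).1
  simpa [sub_le_iff_le_add] using (hb n).2

end

/-! ### Convergence in distribution -/

/-- Half-open intervals form a π-system containing arbitrarily small neighbourhoods of each point,
and their masses are differences of distribution functions. -/
lemma tendsto_probabilityMeasure_of_tendsto_Iic {μ : ℕ → ProbabilityMeasure ℝ}
    {ν : ProbabilityMeasure ℝ}
    (h : ∀ s : ℝ, Tendsto (fun n => (μ n : Measure ℝ).real (Set.Iic s)) atTop
      (𝓝 ((ν : Measure ℝ).real (Set.Iic s)))) :
    Tendsto μ atTop (𝓝 ν) := by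
  refine IsPiSystem.tendsto_probabilityMeasure_of_tendsto_of_mem
    (S := {S | ∃ a b : ℝ, a < b ∧ Set.Ioc a b = S}) ?_ ?_ ?_ ?_
  · simpa using isPiSystem_Ioc (id : ℝ → ℝ) id
  · rintro _ ⟨a, b, -, rfl⟩
    exact measurableSet_Ioc
  · intro u hu x hx
    obtain ⟨ε, hε, hsub⟩ := Metric.isOpen_iff.1 hu x hx
    refine ⟨_, ⟨x - ε / 2, x + ε / 2, by linarith, rfl⟩,
      Ioc_mem_nhds (by linarith) (by linarith), fun y hy => hsub ?_⟩
    rw [Metric.mem_ball, Real.dist_eq, abs_lt]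
    constructor <;> linarith [hy.1, hy.2]
  · rintro _ ⟨a, b, hab, rfl⟩
    have e : ∀ ρ : ProbabilityMeasure ℝ, ((ρ (Set.Ioc a b) : NNReal) : ℝ)
        = (ρ : Measure ℝ).real (Set.Iic b) - (ρ : Measure ℝ).real (Set.Iic a) := fun ρ => by
      rw [← measureReal_sdiff (Set.Iic_subset_Iic.2 hab.le) measurableSet_Iic]
      have : Set.Iic b \ Set.Iic a = Set.Ioc a b := by
        ext y
        simp [and_comm]
      rw [this]
      rfl
    rw [← NNReal.tendsto_coe]
    simp only [e]
    exact (h b).sub (h a)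

lemma gumbelMeasure_real_Iic (s : ℝ) :
    gumbelMeasure.real (Set.Iic s) = Real.exp (-Real.exp (-s)) := by
  have h0 : Tendsto gumbelCDF atBot (𝓝 0) :=
    Real.tendsto_exp_atBot.comp
      (tendsto_neg_atTop_atBot.comp (Real.tendsto_exp_atTop.comp tendsto_neg_atBot_atTop))
  rw [Measure.real, gumbelMeasure, StieltjesFunction.measure_Iic _ h0, sub_zero]
  exact ENNReal.toReal_ofReal (Real.exp_nonneg _)

lemma map_gumbelMeasure_real_Iic {c : ℝ} (hc : 0 < c) (s : ℝ) :
    (gumbelMeasure.map fun x => x - Real.log c).real (Set.Iic s)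
      = Real.exp (-(Real.exp (-s) / c)) := by
  rw [map_measureReal_apply (by fun_prop) measurableSet_Iic]
  have : (fun x => x - Real.log c) ⁻¹' Set.Iic s = Set.Iic (s + Real.log c) := by
    ext x; simp
  rw [this, gumbelMeasure_real_Iic, neg_add, Real.exp_add, Real.exp_neg (Real.log c),
    Real.exp_log hc, div_eq_mul_inv]

end ExpandingBRW

theorem mainTheorem4 {Ω : Type*} [MeasurableSpace Ω] (P : Measure Ω) [IsProbabilityMeasure P]
    (k : ℕ) (hk : 2 ≤ k) (α : ℝ) (hα : 0 < α)
    (W : ExpandingBRW.Vertex k → Ω → ℝ)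
    (hW : ∀ v, HasLaw (W v) (expMeasure 1) P)
    (hindep : iIndepFun W P) :
    TendstoInDistribution (fun n => ExpandingBRW.tau (ExpandingBRW.q k α) W n) atTop
        (fun x : ℝ => x - Real.log (ExpandingBRW.phiInf (ExpandingBRW.q k α)))
        (fun _ => P) ExpandingBRW.gumbelMeasure ∧
      ∀ s : ℝ, Tendsto
        (fun n : ℕ => P.real {ω | ExpandingBRW.tau (ExpandingBRW.q k α) W n ω ≤ s}) atTop
        (𝓝 (Real.exp (-(Real.exp (-s) / ExpandingBRW.phiInf (ExpandingBRW.q k α))))) := by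
  have hq0 := ExpandingBRW.q_pos hk α
  have hq1 := ExpandingBRW.q_lt_one hk hα
  have hcdf := ExpandingBRW.tendsto_measureReal_tau_le hk hq0 hq1 hW hindep
  have hm : ∀ n, AEMeasurable (ExpandingBRW.tau (ExpandingBRW.q k α) W n) P :=
    ExpandingBRW.aemeasurable_tau (fun v => (hW v).aemeasurable)
  refine ⟨⟨hm, by fun_prop, ?_⟩, hcdf⟩
  refine ExpandingBRW.tendsto_probabilityMeasure_of_tendsto_Iic fun s => ?_
  simp only [ProbabilityMeasure.coe_mk]
  rw [ExpandingBRW.map_gumbelMeasure_real_Iic (ExpandingBRW.phiInf_pos hq0 hq1)]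
  refine (hcdf s).congr fun n => ?_
  rw [map_measureReal_apply_of_aemeasurable (hm n) measurableSet_Iic]
  rfl
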